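/- Let $E$ be a reflexive real Banach space whose dual is separable, let $[t_0,T]\subset\mathbb R$, and let $(\Omega,\mathcal F,(\mathcal F_t)_{t\in[t_0,T]},\mathbb P)$ be a complete filtered probability space satisfying the usual conditions (the filtration is right-continuous and every $\mathcal F_t$ contains all $\mathbb P$-null sets). A set-valued map $X$ on a measurable space $(M,\mathcal M)$ with values in the subsets of $E$ is called $\mathcal M$-measurable if $\{m: X(m)\cap O\neq\emptyset\}\in\mathcal M$ for every open $O\subseteq E$. A random closed set is an $\mathcal F$-measurable map on $\Omega$ whose values are non-empty closed subsets of $E$. Let $B=(B_t)_{t\in[t_0,T]}$ and $G=(G_t)_{t\in[t_0,T]}$ be families of maps from $\Omega$ to the non-empty closed subsets of $E$ such that: - $B_t$ is $\mathcal F_t$-measurable for every $t\in[t_0,T]$, and $B_s(\omega)\subseteq B_t(\omega)$ for all $\omega$ and all $s<t$ in $[t_0,T]$; - $0\in G(\omega,t)$ and $G(\omega,t)$ is convex for all $(\omega,t)$, and there is a closed bounded $K\subseteq E$ with $G(\omega,t)\subseteq K$ for all $(\omega,t)$; - $G$ is measurable with respect to the previsible $\sigma$-algebra on $\Omega\times[t_0,T]$,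 that is, the smallest $\sigma$-algebra for which every process $X$ that has non-empty closed values in $E$, is adapted, and almost surely has trajectories left-continuous in the Hausdorff distance at every point of $[t_0,T]$, is a measurable set-valued map. For $A,C\subseteq E$ put $A\oplus C=\overline{\{a+c: a\in A,\ c\in C\}}$ (so $\emptyset\oplus C=\emptyset$). For $a\le b$ in $[t_0,T]$ let $\int_a^b G(\tau)\,d\tau$ be the Aumann integral with respect to Lebesgue measure: its value at $\omega$ is the set of all Bochner integrals $\int_a^b x(\tau)\,d\tau$ with $x\in L^1([t_0,T];E)$ and $x(\tau)\in G(\omega,\tau)$ for almost every $\tau$. Let $t\in[t_0,T]$, $n\in\mathbb N=\{0,1,2,\dots\}$, and let $\Pi=(t_i)_{i=0}^n$, $t_0<t_1<\dots<t_n=t$, be a partition of $[t_0,t]$. Put $\Delta B_{t_i}=B_{t_i}\setminus \operatorname{int} B_{t_{i-1}}$ for $1\le i\le n$, and $$s_\Pi=\Bigl(B_{t_0}\oplus\int_{t_0}^tG(\tau)\,d\tau\Bigr)\cup\bigcup_{i=1}^n\Bigl(\Delta B_{t_i}\oplus\int_{t_i}^tG(\tau)\,d\tau\Bigr),$$ $$S_\Pi=\Bigl(B_{t_0}\oplus\int_{t_0}^tG(\tau)\,d\tau\Bigr)\cup\bigcup_{i=1}^n\Bigl(\Delta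 B_{t_i}\oplus\int_{t_{i-1}}^tG(\tau)\,d\tau\Bigr).$$ Then both $s_\Pi$ and $S_\Pi$ are random closed sets. -/

import Mathlib

open MeasureTheory Filter Topology Set

open scoped Pointwise

namespace BirthGrowth

/-- Measurability of a set-valued map `X` with respect to a σ-algebra `m`: the inverse image
`X⁻¹(O) = {a | X a ∩ O ≠ ∅}` of every open set `O` belongs to `m`. -/
def IsMeasurableSetValued {α E : Type*} [TopologicalSpace E] (m : MeasurableSpace α)
    (X : α → Set E) : Prop :=
  ∀ O : Set E, IsOpen O → MeasurableSet[m] {a | (X a ∩ O).Nonempty}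

/-- `X` is a measurable set-valued map (with respect to `m`) with non-empty closed values.
When `m` is the σ-algebra of a complete probability space, this says that `X` is a random
closed set. -/
structure IsRandomClosedSet {α E : Type*} [TopologicalSpace E] (m : MeasurableSpace α)
    (X : α → Set E) : Prop where
  nonempty : ∀ a, (X a).Nonempty
  isClosed : ∀ a, IsClosed (X a)
  measurable : IsMeasurableSetValued m X

/-- The closed Minkowski sum `A ⊕ B`, the closure of `A + B = {a + b | a ∈ A, b ∈ B}`. -/
def closedMinkowskiSum {E : Type*} [TopologicalSpace E] [Add E] (A B : Set E) : Set E :=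
  closure (A + B)

/-- The Aumann integral `∫_A X dμ`: the set of all Bochner integrals `∫_A x dμ`, where `x` runs
through the `μ`-integrable functions with `x ∈ X` almost everywhere. -/
def aumannIntegral {α E : Type*} [MeasurableSpace α] [NormedAddCommGroup E] [NormedSpace ℝ E]
    (μ : Measure α) (A : Set α) (X : α → Set E) : Set E :=
  {y | ∃ x : α → E, Integrable x μ ∧ (∀ᵐ a ∂μ, x a ∈ X a) ∧ y = ∫ a in A, x a ∂μ}

/-- A Banach space is reflexive if the canonical map into its bidual is onto. -/
def IsReflexiveSpace (E : Type*) [NormedAddCommGroup E] [NormedSpace ℝ E] : Prop :=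
  Function.Surjective (NormedSpace.inclusionInDoubleDual ℝ E)

/-- Lebesgue measure on the compact interval `[t₀, T]`. -/
noncomputable def lebesgueIcc (t₀ T : ℝ) : Measure (Icc t₀ T) :=
  (volume : Measure ℝ).comap Subtype.val

section SetProcesses

variable {Ω E : Type*} {mΩ : MeasurableSpace Ω} {t₀ T : ℝ}

/-- The usual conditions: the filtration is right-continuous and each of its members contains
all `ℙ`-null sets. -/
structure UsualConditions (ℙ : Measure Ω) (ℱ : Filtration (Icc t₀ T) mΩ) : Prop where
  rightContinuous : ℱ.IsRightContinuous
  null : ∀ (t : Icc t₀ T) (N : Set Ω), ℙ N = 0 → MeasurableSet[ℱ t] N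

/-- `X` is an adapted process with non-empty closed values. -/
def IsAdaptedClosed [TopologicalSpace E] (ℱ : Filtration (Icc t₀ T) mΩ)
    (X : Ω → Icc t₀ T → Set E) : Prop :=
  ∀ t, IsRandomClosedSet (ℱ t) (fun ω => X ω t)

/-- Almost surely, the trajectory of `X` is left-continuous in the Hausdorff distance at every
point of `[t₀, T]`. -/
def HasLeftContinuousTrajectories [PseudoEMetricSpace E] (ℙ : Measure Ω)
    (X : Ω → Icc t₀ T → Set E) : Prop :=
  ∀ᵐ ω ∂ℙ, ∀ u : Icc t₀ T,
    Tendsto (fun s => Metric.hausdorffEDist (X ω s) (X ω u)) (𝓝[<] u) (𝓝 0)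

/-- The previsible σ-algebra on `Ω × [t₀, T]`: the one generated by the adapted processes with
non-empty closed values in `E` and left-continuous trajectories, i.e. the smallest σ-algebra for
which all these processes are measurable set-valued maps. -/
@[reducible]
def previsible (E : Type*) [PseudoEMetricSpace E] (ℙ : Measure Ω)
    (ℱ : Filtration (Icc t₀ T) mΩ) : MeasurableSpace (Ω × Icc t₀ T) :=
  MeasurableSpace.generateFrom
    {S | ∃ (X : Ω → Icc t₀ T → Set E) (O : Set E),
      IsAdaptedClosed ℱ X ∧ HasLeftContinuousTrajectories ℙ X ∧ IsOpen O ∧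
        S = {p : Ω × Icc t₀ T | (X p.1 p.2 ∩ O).Nonempty}}

/-- `t₀ = p 0 < p 1 < ⋯ < p n = t` is a partition of `[t₀, t]`. -/
structure IsPartition (t : Icc t₀ T) {n : ℕ} (p : Fin (n + 1) → Icc t₀ T) : Prop where
  strictMono : StrictMono p
  first : (p 0 : ℝ) = t₀
  last : p (Fin.last n) = t

variable [NormedAddCommGroup E] [NormedSpace ℝ E]

/-- The increment `ΔB_{t_i} = B_{t_i} \ int B_{t_{i-1}}` for `i = 1, …, n` (indexed here by
`i - 1 : Fin n`). -/
def increment (B : Ω → Icc t₀ T → Set E) {n : ℕ} (p : Fin (n + 1) → Icc t₀ T) (i : Fin n)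
    (ω : Ω) : Set E :=
  B ω (p i.succ) \ interior (B ω (p i.castSucc))

/-- The Aumann integral `∫_a^b G(ω, τ) dτ`. -/
noncomputable def growth (G : Ω → Icc t₀ T → Set E) (a b : Icc t₀ T) (ω : Ω) : Set E :=
  aumannIntegral (lebesgueIcc t₀ T) (Icc a b) (G ω)

/-- The lower sum
`s_Π(t) = (B_{t_0} ⊕ ∫_{t_0}^t G) ∪ ⋃_{i=1}^n (ΔB_{t_i} ⊕ ∫_{t_i}^t G)`. -/
noncomputable def lowerSum (B G : Ω → Icc t₀ T → Set E) (t : Icc t₀ T) {n : ℕ}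
    (p : Fin (n + 1) → Icc t₀ T) (ω : Ω) : Set E :=
  closedMinkowskiSum (B ω (p 0)) (growth G (p 0) t ω) ∪
    ⋃ i : Fin n, closedMinkowskiSum (increment B p i ω) (growth G (p i.succ) t ω)

/-- The upper sum
`S_Π(t) = (B_{t_0} ⊕ ∫_{t_0}^t G) ∪ ⋃_{i=1}^n (ΔB_{t_i} ⊕ ∫_{t_{i-1}}^t G)`. -/
noncomputable def upperSum (B G : Ω → Icc t₀ T → Set E) (t : Icc t₀ T) {n : ℕ}
    (p : Fin (n + 1) → Icc t₀ T) (ω : Ω) : Set E :=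
  closedMinkowskiSum (B ω (p 0)) (growth G (p 0) t ω) ∪
    ⋃ i : Fin n, closedMinkowskiSum (increment B p i ω) (growth G (p i.castSucc) t ω)

end SetProcesses

end BirthGrowth

namespace BirthGrowth

open scoped ENNReal
open TopologicalSpace (SeparableSpace denseSeq countableBasis)

section Dual

/-- A normed space whose dual is separable is separable. -/
theorem separableSpace_of_separableSpace_dual (E : Type*) [NormedAddCommGroup E]
    [NormedSpace ℝ E] [SeparableSpace (StrongDual ℝ E)] : SeparableSpace E := by
  have hx : ∀ f : StrongDual ℝ E, ∃ x : E, ‖x‖ ≤ 1 ∧ ‖f‖ / 2 ≤ f x := by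
    intro f
    rcases eq_or_ne f 0 with rfl | hf
    · exact ⟨0, by simp⟩
    have hlt : ‖f‖ / 2 < ‖f‖ := half_lt_self (norm_pos_iff.2 hf)
    obtain ⟨x, hx1, hx2⟩ := f.exists_lt_apply_of_lt_opNorm hlt
    rcases le_total 0 (f x) with h | h
    · exact ⟨x, hx1.le, by rw [Real.norm_of_nonneg h] at hx2; exact hx2.le⟩
    · exact ⟨-x, by simpa using hx1.le, by
        rw [Real.norm_of_nonpos h] at hx2; simpa using hx2.le⟩
  choose x hx1 hx2 using hx
  let S : Submodule ℝ E :=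
    (Submodule.span ℝ (range fun n => x (denseSeq (StrongDual ℝ E) n))).topologicalClosure
  have hsep : TopologicalSpace.IsSeparable (S : Set E) := by
    rw [Submodule.topologicalClosure_coe]
    exact ((countable_range _).isSeparable.span).closure
  suffices h : S = ⊤ by
    rw [h] at hsep
    exact TopologicalSpace.isSeparable_univ_iff.1 hsep
  by_contra hS
  obtain ⟨v, hv⟩ : ∃ v, v ∉ S := by
    by_contra! h
    exact hS (Submodule.eq_top_iff'.2 h)
  obtain ⟨f, hfv, hfS⟩ : ∃ f : StrongDual ℝ E, f v ≠ 0 ∧ ∀ y ∈ S, f y = 0 := by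
    obtain ⟨f, u, hfu, huv⟩ := geometric_hahn_banach_closed_point (E := E)
      S.convex (Submodule.isClosed_topologicalClosure _) hv
    have hzero : ∀ y ∈ S, f y = 0 := by
      intro y hy
      by_contra hne
      have := hfu _ (S.smul_mem (u / f y) hy)
      simp [hne] at this
    have h0 := hfu 0 S.zero_mem
    rw [map_zero] at h0
    exact ⟨f, (h0.trans huv).ne', hzero⟩
  have hf : f = 0 := by
    by_contra hne
    have hpos : 0 < ‖f‖ := norm_pos_iff.2 hne
    obtain ⟨n, hn⟩ := (TopologicalSpace.denseRange_denseSeq (StrongDual ℝ E)).exists_dist_lt f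
      (show 0 < ‖f‖ / 4 by positivity)
    set g := denseSeq (StrongDual ℝ E) n
    have hmem : x g ∈ S := Submodule.le_topologicalClosure _ (Submodule.subset_span ⟨n, rfl⟩)
    have h1 := hx2 g
    have h2 : (g - f) (x g) ≤ ‖g - f‖ :=
      (le_abs_self _).trans (((g - f).le_opNorm (x g)).trans
        (mul_le_of_le_one_right (norm_nonneg _) (hx1 g)))
    have h3 : ‖f‖ ≤ ‖g‖ + ‖g - f‖ := by
      have := norm_sub_le g (g - f)
      simpa using this
    rw [dist_comm, dist_eq_norm] at hn
    simp only [sub_apply, hfS _ hmem, sub_zero] at h2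
    linarith
  simp [hf] at hfv

end Dual

section SetValued

variable {α E : Type*} {m : MeasurableSpace α}

theorem IsMeasurableSetValued.of_isTopologicalBasis [TopologicalSpace E] {b : Set (Set E)}
    (hb : TopologicalSpace.IsTopologicalBasis b) [SecondCountableTopology E] {X : α → Set E}
    (h : ∀ U ∈ b, MeasurableSet {a | (X a ∩ U).Nonempty}) : IsMeasurableSetValued m X := by
  intro O hO
  obtain ⟨S, hSb, rfl⟩ := hb.open_eq_sUnion hO
  obtain ⟨S', hS'c, hS'S, hS'⟩ := TopologicalSpace.isOpen_sUnion_countable S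
    fun s hs => hb.isOpen (hSb hs)
  rw [← hS']
  have : {a | (X a ∩ ⋃₀ S').Nonempty} = ⋃ U ∈ S', {a | (X a ∩ U).Nonempty} := by
    ext a
    simp only [sUnion_eq_biUnion, inter_iUnion, nonempty_iUnion, mem_iUnion, exists_prop,
      mem_ofPred_eq]
  rw [this]
  exact MeasurableSet.biUnion hS'c fun U hU => h U (hSb (hS'S hU))

theorem IsMeasurableSetValued.union [TopologicalSpace E] {X Y : α → Set E}
    (hX : IsMeasurableSetValued m X) (hY : IsMeasurableSetValued m Y) :
    IsMeasurableSetValued m fun a => X a ∪ Y a := by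
  intro O hO
  simp only [union_inter_distrib_right, union_nonempty]
  exact (hX O hO).union (hY O hO)

theorem IsMeasurableSetValued.iUnion [TopologicalSpace E] {ι : Type*} [Countable ι]
    {X : ι → α → Set E} (hX : ∀ i, IsMeasurableSetValued m (X i)) :
    IsMeasurableSetValued m fun a => ⋃ i, X i a := by
  intro O hO
  simp only [iUnion_inter, nonempty_iUnion, ofPred_exists]
  exact MeasurableSet.iUnion fun i => hX i O hO

theorem IsMeasurableSetValued.closedMinkowskiSum [TopologicalSpace E] [Add E] [ContinuousAdd E]
    [SecondCountableTopology E] {X Y : α → Set E}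
    (hX : IsMeasurableSetValued m X) (hY : IsMeasurableSetValued m Y) :
    IsMeasurableSetValued m fun a => closedMinkowskiSum (X a) (Y a) := by
  intro O hO
  let b := countableBasis E
  have hb := TopologicalSpace.isBasis_countableBasis E
  have : {a | (BirthGrowth.closedMinkowskiSum (X a) (Y a) ∩ O).Nonempty} =
      ⋃ U ∈ b, ⋃ V ∈ b, ⋃ (_ : U + V ⊆ O),
        ({a | (X a ∩ U).Nonempty} ∩ {a | (Y a ∩ V).Nonempty}) := by
    ext a
    simp only [mem_ofPred_eq, mem_iUnion, exists_prop, mem_inter_iff,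
      BirthGrowth.closedMinkowskiSum, closure_inter_open_nonempty_iff hO]
    constructor
    · rintro ⟨_, ⟨x, hx, y, hy, rfl⟩, hz⟩
      obtain ⟨u, v, hu, hv, hxu, hyv, huv⟩ := isOpen_prod_iff.1
        (hO.preimage (continuous_add (M := E))) x y hz
      obtain ⟨U, hU, hxU, hUu⟩ := hb.exists_subset_of_mem_open hxu hu
      obtain ⟨V, hV, hyV, hVv⟩ := hb.exists_subset_of_mem_open hyv hv
      refine ⟨U, hU, V, hV, ?_, ⟨x, hx, hxU⟩, ⟨y, hy, hyV⟩⟩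
      rintro _ ⟨x', hx', y', hy', rfl⟩
      exact huv (mk_mem_prod (hUu hx') (hVv hy'))
    · rintro ⟨U, hU, V, hV, hUV, ⟨x, hx, hxU⟩, ⟨y, hy, hyV⟩⟩
      exact ⟨x + y, Set.add_mem_add hx hy, hUV (Set.add_mem_add hxU hyV)⟩
  rw [this]
  have hc := TopologicalSpace.countable_countableBasis E
  exact MeasurableSet.biUnion hc fun U hU => MeasurableSet.biUnion hc fun V hV =>
    MeasurableSet.iUnion fun _ =>
      (hX U (hb.isOpen hU)).inter (hY V (hb.isOpen hV))

theorem IsMeasurableSetValued.measurable_infEDist [PseudoEMetricSpace E] {X : α → Set E}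
    (hX : IsMeasurableSetValued m X) (u : E) : Measurable fun a => Metric.infEDist u (X a) := by
  refine measurable_of_Iio fun r => ?_
  have : (fun a => Metric.infEDist u (X a)) ⁻¹' Iio r =
      {a | (X a ∩ Metric.eball u r).Nonempty} := by
    ext a
    simp only [mem_preimage, mem_Iio, Metric.infEDist_lt_iff, mem_ofPred_eq]
    exact ⟨fun ⟨y, hy, h⟩ => ⟨y, hy, by rwa [Metric.mem_eball']⟩,
      fun ⟨y, hy, h⟩ => ⟨y, hy, by rwa [Metric.mem_eball'] at h⟩⟩
  rw [this]
  exact hX _ Metric.isOpen_eball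

/-- An open set is hit by `X` if and only if one of countably many balls contained in it is hit
by `X`. -/
theorem nonempty_inter_iff_exists_infEDist_lt [PseudoEMetricSpace E] {D : Set E} (hD : Dense D)
    {X O : Set E} (hO : IsOpen O) :
    (X ∩ O).Nonempty ↔
      ∃ u ∈ D, ∃ k : ℕ, Metric.eball u (k : ℝ≥0∞)⁻¹ ⊆ O ∧
        Metric.infEDist u X < (k : ℝ≥0∞)⁻¹ := by
  constructor
  · rintro ⟨x, hx, hxO⟩
    obtain ⟨ε, hε, hεO⟩ := EMetric.isOpen_iff.1 hO x hxO
    obtain ⟨k, hk⟩ := ENNReal.exists_inv_nat_lt (ENNReal.half_pos hε.ne').ne'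
    have hk0 : (0 : ℝ≥0∞) < (k : ℝ≥0∞)⁻¹ := by simp
    obtain ⟨u, huD, hu⟩ := EMetric.mem_closure_iff.1 (hD x) _ hk0
    refine ⟨u, huD, k, ?_, ?_⟩
    · refine Subset.trans ?_ hεO
      intro y hy
      rw [Metric.mem_eball] at hy ⊢
      calc edist y x ≤ edist y u + edist u x := edist_triangle _ _ _
        _ < ε / 2 + ε / 2 := ENNReal.add_lt_add (hy.trans hk)
            (by rw [edist_comm]; exact hu.trans hk)
        _ = ε := ENNReal.add_halves ε
    · exact Metric.infEDist_lt_iff.2 ⟨x, hx, by rwa [edist_comm]⟩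
  · rintro ⟨u, -, k, hk, h⟩
    obtain ⟨y, hy, hyu⟩ := Metric.infEDist_lt_iff.1 h
    exact ⟨y, hy, hk (by rwa [Metric.mem_eball'])⟩

end SetValued

section Increment

variable {α E : Type*} {m : MeasurableSpace α}

theorem diff_interior_inter_nonempty_iff [TopologicalSpace E] {X Y U : Set E}
    (hX : IsClosed X) (hXY : X ⊆ Y)
    (hU : IsOpen U) (hUc : IsPreconnected U) :
    ((Y \ interior X) ∩ U).Nonempty ↔
      ((Y \ X) ∩ U).Nonempty ∨ (X ∩ U).Nonempty ∧ ((univ \ X) ∩ U).Nonempty := by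
  constructor
  · rintro ⟨y, ⟨hyY, hyX⟩, hyU⟩
    by_cases hy : y ∈ X
    · refine Or.inr ⟨⟨y, hy, hyU⟩, ?_⟩
      by_contra h
      refine hyX (interior_maximal (fun z hz => ?_) hU hyU)
      by_contra hzX
      exact h ⟨z, ⟨mem_univ z, hzX⟩, hz⟩
    · exact Or.inl ⟨y, ⟨hyY, hy⟩, hyU⟩
  · rintro (⟨y, ⟨hyY, hyX⟩, hyU⟩ | ⟨⟨x, hxX, hxU⟩, ⟨z, ⟨-, hzX⟩, hzU⟩⟩)
    · exact ⟨y, ⟨hyY, fun h => hyX (interior_subset h)⟩, hyU⟩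
    · by_contra h
      have hsub : ∀ y ∈ X, y ∈ U → y ∈ interior X := fun y hy hyU => by
        by_contra hyX
        exact h ⟨y, ⟨hXY hy, hyX⟩, hyU⟩
      obtain ⟨y, -, hy1, hy2⟩ := hUc (interior X) Xᶜ isOpen_interior hX.isOpen_compl
        (fun y hy => (em (y ∈ X)).imp (fun h => hsub y h hy) id)
        ⟨x, hxU, hsub x hxX hxU⟩ ⟨z, hzU, hzX⟩
      exact hy2 (interior_subset hy1)

/-- A set meets the complement of a closed set inside an open set `U` if and only if it hits a
basic open subset of `U` that misses the closed set. -/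
theorem diff_inter_nonempty_iff [TopologicalSpace E] [SecondCountableTopology E] {X Y U : Set E}
    (hX : IsClosed X)
    (hU : IsOpen U) :
    ((Y \ X) ∩ U).Nonempty ↔
      ∃ V ∈ countableBasis E, V ⊆ U ∧ ¬ (X ∩ V).Nonempty ∧ (Y ∩ V).Nonempty := by
  constructor
  · rintro ⟨y, ⟨hyY, hyX⟩, hyU⟩
    obtain ⟨V, hV, hyV, hVU⟩ :=
      (TopologicalSpace.isBasis_countableBasis E).exists_subset_of_mem_open
        (show y ∈ U ∩ Xᶜ from ⟨hyU, hyX⟩) (hU.inter hX.isOpen_compl)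
    exact ⟨V, hV, fun z hz => (hVU hz).1, fun ⟨z, hzX, hzV⟩ => (hVU hzV).2 hzX, y, hyY, hyV⟩
  · rintro ⟨V, -, hVU, hXV, y, hyY, hyV⟩
    exact ⟨y, ⟨hyY, fun h => hXV ⟨y, h, hyV⟩⟩, hVU hyV⟩

theorem IsMeasurableSetValued.measurableSet_diff_inter [TopologicalSpace E]
    [SecondCountableTopology E] {X Y : α → Set E}
    (hX : IsMeasurableSetValued m X) (hY : IsMeasurableSetValued m Y)
    (hXc : ∀ a, IsClosed (X a)) {U : Set E} (hU : IsOpen U) :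
    MeasurableSet {a | ((Y a \ X a) ∩ U).Nonempty} := by
  have : {a | ((Y a \ X a) ∩ U).Nonempty} = ⋃ V ∈ countableBasis E, ⋃ (_ : V ⊆ U),
      ({a | (X a ∩ V).Nonempty}ᶜ ∩ {a | (Y a ∩ V).Nonempty}) := by
    ext a
    simp only [mem_ofPred_eq, diff_inter_nonempty_iff (hXc a) hU, mem_iUnion, exists_prop,
      mem_inter_iff, mem_compl_iff]
  rw [this]
  have hb := TopologicalSpace.isBasis_countableBasis E
  exact MeasurableSet.biUnion (TopologicalSpace.countable_countableBasis E) fun V hV =>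
    MeasurableSet.iUnion fun _ => (hX V (hb.isOpen hV)).compl.inter (hY V (hb.isOpen hV))

theorem IsMeasurableSetValued.const [TopologicalSpace E] (Y : Set E) :
    IsMeasurableSetValued m fun _ : α => Y :=
  fun _ _ => MeasurableSet.const _

theorem IsMeasurableSetValued.diff_interior [NormedAddCommGroup E] [NormedSpace ℝ E]
    [SecondCountableTopology E] {X Y : α → Set E} (hX : IsMeasurableSetValued m X) (hY : IsMeasurableSetValued m Y)
    (hXc : ∀ a, IsClosed (X a)) (hXY : ∀ a, X a ⊆ Y a) :
    IsMeasurableSetValued m fun a => Y a \ interior (X a) := by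
  have hb : TopologicalSpace.IsTopologicalBasis
      {U : Set E | ∃ x r, U = Metric.ball x r} := by
    refine TopologicalSpace.isTopologicalBasis_of_isOpen_of_nhds ?_ ?_
    · rintro _ ⟨x, r, rfl⟩
      exact Metric.isOpen_ball
    · intro x O hx hO
      obtain ⟨r, hr, hrO⟩ := Metric.isOpen_iff.1 hO x hx
      exact ⟨_, ⟨x, r, rfl⟩, Metric.mem_ball_self hr, hrO⟩
  refine .of_isTopologicalBasis hb ?_
  rintro _ ⟨x, r, rfl⟩
  have hU : IsOpen (Metric.ball x r) := Metric.isOpen_ball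
  simp only [fun a => diff_interior_inter_nonempty_iff (hXc a) (hXY a) hU
    (convex_ball x r).isPreconnected]
  refine (hX.measurableSet_diff_inter hY hXc hU).union ((hX _ hU).inter ?_)
  exact hX.measurableSet_diff_inter (IsMeasurableSetValued.const univ) hXc hU

end Increment

section Selection

variable {α E : Type*} {m : MeasurableSpace α} [MetricSpace E] [SecondCountableTopology E]
  [MeasurableSpace E] [BorelSpace E]

theorem measurable_infEDist_apply {f : α → E} {F : α → Set E} (hf : Measurable f)
    (hF : IsMeasurableSetValued m F) :
    Measurable fun a => Metric.infEDist (f a) (F a) :=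
  (measurable_uncurry_of_continuous_of_measurable
    (u := fun (x : E) (a : α) => Metric.infEDist x (F a))
    (fun _ => Metric.continuous_infEDist) hF.measurable_infEDist).comp (hf.prodMk measurable_id)

/-- An improvement step for an approximate measurable selection. -/
theorem exists_measurable_edist_lt_infEDist_lt {f : α → E} {F : α → Set E} (hf : Measurable f)
    (hF : IsMeasurableSetValued m F) (hne : ∀ a, (F a).Nonempty) {δ : ℝ≥0∞} (hδ : 0 < δ) :
    ∃ g : α → E, Measurable g ∧
      ∀ a, edist (f a) (g a) < Metric.infEDist (f a) (F a) + δ ∧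
        Metric.infEDist (g a) (F a) < δ := by
  classical
  rcases isEmpty_or_nonempty α with hα | ⟨⟨a₀⟩⟩
  · exact ⟨f, hf, fun a => hα.elim a⟩
  have : Nonempty E := ⟨f a₀⟩
  have hex : ∀ a, ∃ k, edist (f a) (denseSeq E k) < Metric.infEDist (f a) (F a) + δ ∧
      Metric.infEDist (denseSeq E k) (F a) < δ := by
    intro a
    have hlt : Metric.infEDist (f a) (F a) < Metric.infEDist (f a) (F a) + δ :=
      ENNReal.lt_add_right (Metric.infEDist_ne_top (hne a)) hδ.ne'
    obtain ⟨y, hy, hfy⟩ := Metric.infEDist_lt_iff.1 hlt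
    have hopen : IsOpen (Metric.eball (f a) (Metric.infEDist (f a) (F a) + δ) ∩
        {x | Metric.infEDist x (F a) < δ}) :=
      Metric.isOpen_eball.inter (isOpen_Iio.preimage Metric.continuous_infEDist)
    obtain ⟨k, hk1, hk2⟩ := (TopologicalSpace.denseRange_denseSeq E).exists_mem_open hopen
      ⟨y, by rwa [Metric.mem_eball'], by
        simpa [Metric.infEDist_zero_of_mem hy] using hδ⟩
    exact ⟨k, by rwa [Metric.mem_eball'] at hk1, hk2⟩
  refine ⟨fun a => denseSeq E (Nat.find (hex a)), ?_, fun a => Nat.find_spec (hex a)⟩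
  refine (measurable_from_top (f := denseSeq E)).comp (measurable_find hex fun k => ?_)
  exact (measurableSet_lt (hf.edist measurable_const)
    ((measurable_infEDist_apply hf hF).add measurable_const)).inter
    (measurableSet_lt (hF.measurable_infEDist _) measurable_const)

/-- A closed measurable set-valued map has a measurable selection that is almost as close as
possible to a given measurable function. -/
theorem exists_measurable_selection [CompleteSpace E] {h : α → E} {F : α → Set E}
    (hh : Measurable h) (hF : IsMeasurableSetValued m F) (hne : ∀ a, (F a).Nonempty)
    (hcl : ∀ a, IsClosed (F a)) {η : ℝ≥0∞} (hη : 0 < η) :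
    ∃ f : α → E, Measurable f ∧ (∀ a, f a ∈ F a) ∧
      ∀ a, edist (h a) (f a) ≤ Metric.infEDist (h a) (F a) + η := by
  obtain ⟨ε, hε, hεη⟩ : ∃ ε : ℝ≥0∞, 0 < ε ∧ ε + 2 * (2 * ε) ≤ η ∧ ε ≠ ⊤ := by
    refine ⟨min η 1 / 5, ENNReal.div_pos (by simp [hη.ne']) (by simp), ?_, ?_⟩
    · calc min η 1 / 5 + 2 * (2 * (min η 1 / 5)) = min η 1 / 5 * 5 := by ring
        _ = min η 1 := ENNReal.div_mul_cancel (by simp) (by simp)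
        _ ≤ η := min_le_left _ _
    · exact (ENNReal.div_lt_top (by simp) (by simp)).ne
  obtain ⟨hεη, hεtop⟩ := hεη
  have hpos : ∀ n : ℕ, 0 < ε / 2 ^ n := fun n => ENNReal.div_pos hε.ne' (by simp)
  have step : ∀ (n : ℕ) (f : {f : α → E // Measurable f}), ∃ g : {g : α → E // Measurable g},
      ∀ a, edist (f.1 a) (g.1 a) < Metric.infEDist (f.1 a) (F a) + ε / 2 ^ n ∧
        Metric.infEDist (g.1 a) (F a) < ε / 2 ^ n := by
    rintro n ⟨f, hf⟩
    obtain ⟨g, hg, hfg⟩ := exists_measurable_edist_lt_infEDist_lt hf hF hne (hpos n)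
    exact ⟨⟨g, hg⟩, hfg⟩
  choose next hnext using step
  let s : ℕ → {f : α → E // Measurable f} := fun n => Nat.rec ⟨h, hh⟩ (fun k f => next k f) n
  have hs : ∀ n, s (n + 1) = next n (s n) := fun n => rfl
  have hinf : ∀ n a, Metric.infEDist ((s (n + 1)).1 a) (F a) < ε / 2 ^ n := fun n a => by
    rw [hs]; exact (hnext n (s n) a).2
  have hdist : ∀ a n, edist ((s (n + 1)).1 a) ((s (n + 2)).1 a) ≤ 2 * ε / 2 ^ n := by
    intro a n
    rw [hs (n + 1)]
    refine (hnext (n + 1) (s (n + 1)) a).1.le.trans ?_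
    calc Metric.infEDist ((s (n + 1)).1 a) (F a) + ε / 2 ^ (n + 1)
        ≤ ε / 2 ^ n + ε / 2 ^ n := add_le_add (hinf n a).le
          (ENNReal.div_le_div_left (pow_le_pow_right₀ (by norm_num) (Nat.le_succ n)) _)
      _ = 2 * ε / 2 ^ n := by rw [← two_mul, mul_div_assoc]
  have hC : 2 * ε ≠ ⊤ := ENNReal.mul_ne_top (by simp) hεtop
  have hlim : ∀ a, ∃ x, Tendsto (fun n => (s (n + 1)).1 a) atTop (𝓝 x) := fun a =>
    cauchySeq_tendsto_of_complete (cauchySeq_of_edist_le_geometric_two (2 * ε) hC (hdist a))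
  choose f hf using hlim
  refine ⟨f, measurable_of_tendsto_metrizable (fun n => (s (n + 1)).2)
    (tendsto_pi_nhds.2 hf), fun a => ?_, fun a => ?_⟩
  · rw [Metric.mem_iff_infEDist_zero_of_closed (hcl a)]
    have h1 : Tendsto (fun n => Metric.infEDist ((s (n + 1)).1 a) (F a)) atTop
        (𝓝 (Metric.infEDist (f a) (F a))) :=
      (Metric.continuous_infEDist.tendsto _).comp (hf a)
    have h2 : Tendsto (fun n : ℕ => ε / 2 ^ n) atTop (𝓝 0) := by
      have := ENNReal.Tendsto.const_mul
        (ENNReal.tendsto_pow_atTop_nhds_zero_of_lt_one (r := 2⁻¹) (by norm_num))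
        (Or.inr hεtop)
      simpa [div_eq_mul_inv, ENNReal.inv_pow] using this
    exact le_antisymm (le_of_tendsto_of_tendsto' h1 h2 fun n => (hinf n a).le) zero_le
  · have h1 := edist_le_of_edist_le_geometric_two_of_tendsto₀ (2 * ε) (hdist a) (hf a)
    have h2 := (hnext 0 (s 0) a).1.le
    rw [← hs 0, pow_zero, div_one] at h2
    calc edist (h a) (f a) ≤ edist (h a) ((s 1).1 a) + edist ((s 1).1 a) (f a) :=
          edist_triangle _ _ _
      _ ≤ (Metric.infEDist (h a) (F a) + ε) + 2 * (2 * ε) := add_le_add h2 h1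
      _ ≤ Metric.infEDist (h a) (F a) + η := by
          rw [add_assoc]; gcongr

end Selection

section Previsible

variable {Ω E : Type*} {mΩ : MeasurableSpace Ω} {t₀ T : ℝ}

/-- The largest point of the grid `ℤ / (n + 1)` strictly below `t`, moved into `[t₀, T]`. -/
noncomputable def leftApprox (h : t₀ ≤ T) (n : ℕ) (t : Icc t₀ T) : Icc t₀ T :=
  projIcc t₀ T h (((⌈(t : ℝ) * (n + 1)⌉ - 1 : ℤ) : ℝ) / (n + 1))

theorem tendsto_leftApprox (h : t₀ ≤ T) {t : Icc t₀ T} (ht : t₀ < t) :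
    Tendsto (fun n => leftApprox h n t) atTop (𝓝[<] t) := by
  have hlt : ∀ n : ℕ, ((⌈(t : ℝ) * (n + 1)⌉ - 1 : ℤ) : ℝ) / (n + 1) < t := fun n => by
    rw [div_lt_iff₀ (by positivity)]
    push_cast
    linarith [Int.ceil_lt_add_one ((t : ℝ) * (n + 1))]
  have hge : ∀ n : ℕ, (t : ℝ) - 1 / (n + 1) ≤ ((⌈(t : ℝ) * (n + 1)⌉ - 1 : ℤ) : ℝ) / (n + 1) := by
    intro n
    have hn : (0 : ℝ) < n + 1 := by positivity
    rw [le_div_iff₀ hn, sub_mul, one_div, inv_mul_cancel₀ hn.ne']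
    push_cast
    linarith [Int.le_ceil ((t : ℝ) * (n + 1))]
  have hreal : Tendsto (fun n : ℕ => ((⌈(t : ℝ) * (n + 1)⌉ - 1 : ℤ) : ℝ) / (n + 1)) atTop
      (𝓝 (t : ℝ)) := by
    refine tendsto_of_tendsto_of_tendsto_of_le_of_le ?_ tendsto_const_nhds hge
      fun n => (hlt n).le
    simpa using tendsto_const_nhds.sub (tendsto_one_div_add_atTop_nhds_zero_nat (𝕜 := ℝ))
  refine tendsto_nhdsWithin_iff.2 ⟨?_, Eventually.of_forall fun n => ?_⟩
  · have := ((continuous_projIcc (h := h)).tendsto (t : ℝ)).comp hreal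
    rwa [projIcc_val] at this
  · rw [mem_Iio, ← Subtype.coe_lt_coe, leftApprox, coe_projIcc]
    exact max_lt ht (min_lt_of_right_lt (hlt n))

theorem leftApprox_eq (h : t₀ ≤ T) (n : ℕ) {t : Icc t₀ T} (ht : (t : ℝ) = t₀) :
    leftApprox h n t = t := by
  have : ((⌈(t : ℝ) * (n + 1)⌉ - 1 : ℤ) : ℝ) / (n + 1) ≤ t₀ := by
    refine (div_le_iff₀ (by positivity)).2 (le_of_le_of_eq ?_ (congrArg (· * ((n : ℝ) + 1)) ht))
    push_cast
    linarith [Int.ceil_lt_add_one ((t : ℝ) * (n + 1))]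
  rw [leftApprox, projIcc_of_le_left h this]
  exact Subtype.ext ht.symm

theorem measurable_comp_leftApprox {γ : Type*} [MeasurableSpace γ] (h : t₀ ≤ T) (n : ℕ)
    {g : Ω → Icc t₀ T → γ} (hg : ∀ t, Measurable fun ω => g ω t) :
    Measurable fun q : Ω × Icc t₀ T => g q.1 (leftApprox h n q.2) := by
  have h1 : Measurable fun q : Ω × ℤ => g q.1 (projIcc t₀ T h (((q.2 - 1 : ℤ) : ℝ) / (n + 1))) :=
    measurable_from_prod_countable_left fun k =>
      hg (projIcc t₀ T h (((k - 1 : ℤ) : ℝ) / (n + 1)))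
  have h2 : Measurable fun q : Ω × Icc t₀ T => (q.1, ⌈(q.2 : ℝ) * (n + 1)⌉) := by
    fun_prop
  exact h1.comp h2

theorem tendsto_infEDist_of_tendsto_hausdorffEDist [PseudoEMetricSpace E] {ι : Type*}
    {l : Filter ι} {X : ι → Set E} {Y : Set E}
    (h : Tendsto (fun i => Metric.hausdorffEDist (X i) Y) l (𝓝 0)) (u : E) :
    Tendsto (fun i => Metric.infEDist u (X i)) l (𝓝 (Metric.infEDist u Y)) := by
  refine tendsto_of_tendsto_of_tendsto_of_le_of_le
    (g := fun i => Metric.infEDist u Y - Metric.hausdorffEDist (X i) Y)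
    (h := fun i => Metric.infEDist u Y + Metric.hausdorffEDist (X i) Y) ?_ ?_ ?_ ?_
  · simpa using ENNReal.Tendsto.sub (tendsto_const_nhds (x := Metric.infEDist u Y)) h
      (Or.inr ENNReal.zero_ne_top)
  · simpa using (tendsto_const_nhds (x := Metric.infEDist u Y)).add h
  · intro i
    exact tsub_le_iff_right.2 Metric.infEDist_le_infEDist_add_hausdorffEDist
  · intro i
    dsimp only
    rw [Metric.hausdorffEDist_comm]
    exact Metric.infEDist_le_infEDist_add_hausdorffEDist

/-- Up to a null set of `Ω`, previsible sets belong to the product σ-algebra. -/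
theorem exists_measurableSet_of_previsible [PseudoEMetricSpace E] [SeparableSpace E]
    {ℙ : Measure Ω} {ℱ : Filtration (Icc t₀ T) mΩ} {S : Set (Ω × Icc t₀ T)}
    (hS : MeasurableSet[previsible E ℙ ℱ] S) :
    ∃ S' : Set (Ω × Icc t₀ T), MeasurableSet S' ∧
      ∀ᵐ ω ∂ℙ, ∀ τ, (ω, τ) ∈ S ↔ (ω, τ) ∈ S' := by
  induction S, hS using MeasurableSpace.generateFrom_induction with
  | hC S hS _ =>
    obtain ⟨X, O, hX, hXl, hO, rfl⟩ := hS
    rcases lt_or_ge T t₀ with hT | hT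
    · exact ⟨∅, MeasurableSet.empty, .of_forall fun ω τ => absurd (τ.2.1.trans τ.2.2) hT.not_ge⟩
    obtain ⟨D, hDc, hD⟩ := TopologicalSpace.exists_countable_dense E
    let d : E → Ω × Icc t₀ T → ℝ≥0∞ := fun u q =>
      limsup (fun n => Metric.infEDist u (X q.1 (leftApprox hT n q.2))) atTop
    have hd : ∀ u, Measurable (d u) := fun u => Measurable.limsup fun n =>
      measurable_comp_leftApprox hT n (g := fun ω t => Metric.infEDist u (X ω t)) fun t =>
        ((hX t).measurable.measurable_infEDist u).mono (ℱ.le t) le_rfl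
    refine ⟨⋃ u ∈ D, ⋃ k : ℕ, ⋃ (_ : Metric.eball u (k : ℝ≥0∞)⁻¹ ⊆ O),
      {q | d u q < (k : ℝ≥0∞)⁻¹}, ?_, ?_⟩
    · exact MeasurableSet.biUnion hDc fun u _ => MeasurableSet.iUnion fun k =>
        MeasurableSet.iUnion fun _ => measurableSet_lt (hd u) measurable_const
    · filter_upwards [hXl] with ω hω τ
      have hlim : Tendsto (fun n => Metric.hausdorffEDist (X ω (leftApprox hT n τ)) (X ω τ))
          atTop (𝓝 0) := by
        rcases τ.2.1.eq_or_lt with h | h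
        · simp [leftApprox_eq hT _ h.symm]
        · exact (hω τ).comp (tendsto_leftApprox hT h)
      have hdeq : ∀ u, d u (ω, τ) = Metric.infEDist u (X ω τ) := fun u =>
        (tendsto_infEDist_of_tendsto_hausdorffEDist hlim u).limsup_eq
      simp only [mem_ofPred_eq, mem_iUnion, exists_prop, hdeq,
        nonempty_inter_iff_exists_infEDist_lt hD hO]
  | empty => exact ⟨∅, MeasurableSet.empty, .of_forall fun ω τ => Iff.rfl⟩
  | compl S _ ih =>
    obtain ⟨S', hS', h⟩ := ih
    refine ⟨S'ᶜ, hS'.compl, ?_⟩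
    filter_upwards [h] with ω hω τ
    exact not_congr (hω τ)
  | iUnion S _ ih =>
    choose S' hS' h using ih
    refine ⟨⋃ n, S' n, MeasurableSet.iUnion hS', ?_⟩
    filter_upwards [ae_all_iff.2 h] with ω hω τ
    simp only [mem_iUnion, hω]

/-- Up to a null set of `Ω`, a previsible closed-valued map is jointly measurable. -/
theorem exists_isRandomClosedSet_of_previsible [PseudoEMetricSpace E] [SecondCountableTopology E]
    {ℙ : Measure Ω} [ℙ.IsComplete] {ℱ : Filtration (Icc t₀ T) mΩ} {G : Ω × Icc t₀ T → Set E}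
    (hG : IsRandomClosedSet (previsible E ℙ ℱ) G) :
    ∃ G' : Ω × Icc t₀ T → Set E, IsRandomClosedSet inferInstance G' ∧
      ∀ᵐ ω ∂ℙ, ∀ τ, G' (ω, τ) = G (ω, τ) := by
  classical
  have hb := TopologicalSpace.isBasis_countableBasis E
  choose! S hS hSG using fun (U : Set E) (hU : U ∈ countableBasis E) =>
    exists_measurableSet_of_previsible (hG.measurable U (hb.isOpen hU))
  let A : Set Ω := {ω | ∀ U ∈ countableBasis E, ∀ τ,
    (ω, τ) ∈ {q | (G q ∩ U).Nonempty} ↔ (ω, τ) ∈ S U}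
  have hA : ∀ᵐ ω ∂ℙ, ω ∈ A :=
    (ae_ball_iff (TopologicalSpace.countable_countableBasis E)).2 hSG
  have hAm : MeasurableSet A := by
    rw [← compl_compl A]
    exact (Measure.IsComplete.out' (μ := ℙ) Aᶜ hA).compl
  let G' : Ω × Icc t₀ T → Set E := fun q => if q.1 ∈ A then G q else univ
  refine ⟨G', ⟨fun q => ?_, fun q => ?_, .of_isTopologicalBasis hb fun U hU => ?_⟩, ?_⟩
  · by_cases h : q.1 ∈ A
    · simpa only [G', h, if_true] using hG.nonempty q
    · simpa only [G', h, if_false] using (hG.nonempty q).mono (subset_univ _)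
  · by_cases h : q.1 ∈ A
    · simpa only [G', h, if_true] using hG.isClosed q
    · simpa only [G', h, if_false] using isClosed_univ
  · have : {q | (G' q ∩ U).Nonempty} =
        (Prod.fst ⁻¹' A ∩ S U) ∪ (Prod.fst ⁻¹' Aᶜ ∩ {_q | U.Nonempty}) := by
      ext q
      by_cases h : q.1 ∈ A
      · simpa [G', h] using h U hU q.2
      · simp [G', h]
    rw [this]
    exact ((measurable_fst hAm).inter (hS U hU)).union
      ((measurable_fst hAm.compl).inter (MeasurableSet.const _))
  · filter_upwards [hA] with ω hω τ
    simp only [G', hω, if_true]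

end Previsible

section Aumann

variable {Ω β E : Type*} {mΩ : MeasurableSpace Ω} [MeasurableSpace β] [NormedAddCommGroup E]
  [NormedSpace ℝ E]

theorem edist_setIntegral_le {μ : Measure β} {f g : β → E} (hf : Integrable f μ)
    (hg : Integrable g μ) (A : Set β) :
    edist (∫ b in A, f b ∂μ) (∫ b in A, g b ∂μ) ≤ ∫⁻ b, edist (f b) (g b) ∂μ := by
  rw [edist_eq_enorm_sub, ← integral_sub hf.integrableOn hg.integrableOn]
  simp only [edist_eq_enorm_sub]
  exact (enorm_integral_le_lintegral_enorm _).trans (setLIntegral_le_lintegral _ _)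

/-- The Aumann integral of a jointly measurable closed-valued map depends measurably on the
parameter. -/
theorem IsRandomClosedSet.measurable_aumannIntegral [CompleteSpace E]
    [SecondCountableTopology E] {μ : Measure β} [IsFiniteMeasure μ] [IsSeparable μ]
    {G : Ω × β → Set E} (hG : IsRandomClosedSet inferInstance G) (A : Set β) :
    IsMeasurableSetValued mΩ fun ω => aumannIntegral μ A fun b => G (ω, b) := by
  borelize E
  intro O hO
  have : Fact ((1 : ℝ≥0∞) ≤ 1) := ⟨le_rfl⟩
  have : Fact ((1 : ℝ≥0∞) ≠ ⊤) := ⟨ENNReal.one_ne_top⟩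
  let h : ℕ → Lp E 1 μ := denseSeq (Lp E 1 μ)
  have hm : ∀ j, Measurable (h j) := fun j => (Lp.stronglyMeasurable (h j)).measurable
  have hi : ∀ j, Integrable (h j) μ := fun j => L1.integrable_coeFn (h j)
  have hJ : ∀ j, Measurable fun q : Ω × β => Metric.infEDist (h j q.2) (G q) := fun j =>
    measurable_infEDist_apply ((hm j).comp measurable_snd) hG.measurable
  have key : {ω | ((aumannIntegral μ A fun b => G (ω, b)) ∩ O).Nonempty} =
      ⋃ j, ⋃ k : ℕ, ⋃ (_ : Metric.eball (∫ b in A, h j b ∂μ) (k : ℝ≥0∞)⁻¹ ⊆ O),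
        {ω | ∫⁻ b, Metric.infEDist (h j b) (G (ω, b)) ∂μ < (k : ℝ≥0∞)⁻¹} := by
    ext ω
    simp only [mem_ofPred_eq, mem_iUnion, exists_prop]
    constructor
    · rintro ⟨_, ⟨x, hx, hxG, rfl⟩, hxO⟩
      obtain ⟨ε, hε, hεO⟩ := EMetric.isOpen_iff.1 hO _ hxO
      obtain ⟨k, hk⟩ := ENNReal.exists_inv_nat_lt (ENNReal.half_pos hε.ne').ne'
      obtain ⟨j, hj⟩ := (TopologicalSpace.denseRange_denseSeq (Lp E 1 μ)).exists_mem_open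
        (Metric.isOpen_eball (x := hx.toL1 x) (ε := (k : ℝ≥0∞)⁻¹))
        ⟨hx.toL1 x, Metric.mem_eball_self (by simp)⟩
      have hd : ∫⁻ b, edist (h j b) (x b) ∂μ < (k : ℝ≥0∞)⁻¹ := by
        refine lt_of_eq_of_lt ?_ hj
        rw [Lp.edist_def, eLpNorm_one_eq_lintegral_enorm]
        refine lintegral_congr_ae ?_
        filter_upwards [hx.coeFn_toL1] with b hb
        rw [Pi.sub_apply, hb, edist_eq_enorm_sub]
      refine ⟨j, k, fun y hy => hεO ?_, ?_⟩
      · rw [Metric.mem_eball] at hy ⊢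
        calc edist y (∫ b in A, x b ∂μ)
            ≤ edist y (∫ b in A, h j b ∂μ) + edist (∫ b in A, h j b ∂μ) (∫ b in A, x b ∂μ) :=
              edist_triangle _ _ _
          _ < ε / 2 + ε / 2 := ENNReal.add_lt_add (hy.trans hk)
              ((edist_setIntegral_le (hi j) hx A).trans_lt (hd.trans hk))
          _ = ε := ENNReal.add_halves ε
      · refine lt_of_le_of_lt (lintegral_mono_ae ?_) hd
        filter_upwards [hxG] with b hb
        exact Metric.infEDist_le_edist_of_mem hb
    · rintro ⟨j, k, hjk, hlt⟩
      obtain ⟨r, hr, hrk⟩ := ENNReal.lt_iff_exists_add_pos_lt.1 hlt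
      obtain ⟨η, hη, hηr⟩ := ENNReal.exists_pos_mul_lt (measure_ne_top μ univ)
        (ENNReal.coe_pos.2 hr).ne'
      obtain ⟨f, hf, hfG, hfd⟩ := exists_measurable_selection (hm j)
        (F := fun b => G (ω, b)) (fun U hU => measurable_prodMk_left (hG.measurable U hU))
        (fun b => hG.nonempty _) (fun b => hG.isClosed _) hη
      have hd : ∫⁻ b, edist (f b) (h j b) ∂μ < (k : ℝ≥0∞)⁻¹ := by
        calc ∫⁻ b, edist (f b) (h j b) ∂μ
            ≤ ∫⁻ b, (Metric.infEDist (h j b) (G (ω, b)) + η) ∂μ :=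
              lintegral_mono fun b => by rw [edist_comm]; exact hfd b
          _ = ∫⁻ b, Metric.infEDist (h j b) (G (ω, b)) ∂μ + η * μ univ := by
              rw [lintegral_add_right _ measurable_const, lintegral_const]
          _ ≤ ∫⁻ b, Metric.infEDist (h j b) (G (ω, b)) ∂μ + r := by gcongr
          _ < (k : ℝ≥0∞)⁻¹ := hrk
      have hfi : Integrable f μ := by
        have : Integrable (f - ⇑(h j)) μ := by
          refine ⟨(hf.sub (hm j)).aestronglyMeasurable, ?_⟩
          simp only [HasFiniteIntegral, Pi.sub_apply, ← edist_eq_enorm_sub]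
          exact hd.trans_le le_top
        simpa using this.add (hi j)
      exact ⟨∫ b in A, f b ∂μ, ⟨f, hfi, .of_forall hfG, rfl⟩, hjk
        ((edist_setIntegral_le hfi (hi j) A).trans_lt hd)⟩
  rw [key]
  exact MeasurableSet.iUnion fun j => MeasurableSet.iUnion fun k => MeasurableSet.iUnion fun _ =>
    measurableSet_lt (hJ j).lintegral_prod_right' measurable_const

end Aumann

section Sums

variable {Ω E : Type*} {mΩ : MeasurableSpace Ω} {t₀ T : ℝ}

instance isFiniteMeasure_lebesgueIcc : IsFiniteMeasure (lebesgueIcc t₀ T) := by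
  refine ⟨?_⟩
  rw [lebesgueIcc, comap_subtype_coe_apply measurableSet_Icc, image_univ, Subtype.range_coe]
  exact measure_Icc_lt_top

theorem IsMeasurableSetValued.congr_ae [TopologicalSpace E] {ℙ : Measure Ω} [ℙ.IsComplete]
    {X Y : Ω → Set E} (hX : IsMeasurableSetValued mΩ X) (h : ∀ᵐ ω ∂ℙ, X ω = Y ω) :
    IsMeasurableSetValued mΩ Y := by
  intro O hO
  refine ((hX O hO).nullMeasurableSet (μ := ℙ)).congr ?_ |>.measurable_of_complete
  filter_upwards [h] with ω hω
  exact congrArg (fun Z => (Z ∩ O).Nonempty) hω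

variable [NormedAddCommGroup E] [NormedSpace ℝ E]

theorem zero_mem_growth {G : Ω → Icc t₀ T → Set E} (hG : ∀ ω t, (0 : E) ∈ G ω t)
    (a b : Icc t₀ T) (ω : Ω) : (0 : E) ∈ growth G a b ω :=
  ⟨0, integrable_zero _ _ _, .of_forall fun t => hG ω t, by simp⟩

theorem isMeasurableSetValued_growth [CompleteSpace E] [SecondCountableTopology E]
    {ℙ : Measure Ω} [ℙ.IsComplete] {ℱ : Filtration (Icc t₀ T) mΩ} {G : Ω → Icc t₀ T → Set E}
    (hG : IsRandomClosedSet (previsible E ℙ ℱ) fun q : Ω × Icc t₀ T => G q.1 q.2)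
    (a b : Icc t₀ T) : IsMeasurableSetValued mΩ (growth G a b) := by
  obtain ⟨G', hG', h⟩ := exists_isRandomClosedSet_of_previsible hG
  refine (hG'.measurable_aumannIntegral (μ := lebesgueIcc t₀ T) (Icc a b)).congr_ae (ℙ := ℙ) ?_
  filter_upwards [h] with ω hω
  simp only [growth, hω]

theorem isMeasurableSetValued_increment [SecondCountableTopology E]
    {ℱ : Filtration (Icc t₀ T) mΩ} {B : Ω → Icc t₀ T → Set E} (hB : IsAdaptedClosed ℱ B)
    (hB_mono : ∀ ω, ∀ s t : Icc t₀ T, s < t → B ω s ⊆ B ω t) {n : ℕ}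
    {p : Fin (n + 1) → Icc t₀ T} (hp : StrictMono p) (i : Fin n) :
    IsMeasurableSetValued mΩ (increment B p i) := by
  have hBm : ∀ t, IsMeasurableSetValued mΩ fun ω => B ω t := fun t O hO =>
    ℱ.le t _ ((hB t).measurable O hO)
  exact (hBm _).diff_interior (hBm _) (fun ω => (hB _).isClosed ω)
    fun ω => hB_mono ω _ _ (hp i.castSucc_lt_succ)

/-- A union of `B ⊕ ∫_a^b G` with finitely many sets `ΔB_{t_i} ⊕ ∫_{t_{c i}}^b G` is a random
closed set. -/
theorem isRandomClosedSet_union_iUnion [CompleteSpace E] [SecondCountableTopology E]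
    {ℙ : Measure Ω} [ℙ.IsComplete] {ℱ : Filtration (Icc t₀ T) mΩ} {B G : Ω → Icc t₀ T → Set E}
    (hB : IsAdaptedClosed ℱ B)
    (hB_mono : ∀ ω, ∀ s t : Icc t₀ T, s < t → B ω s ⊆ B ω t)
    (hG_zero : ∀ ω t, (0 : E) ∈ G ω t)
    (hG : IsRandomClosedSet (previsible E ℙ ℱ) fun q : Ω × Icc t₀ T => G q.1 q.2)
    (t : Icc t₀ T) {n : ℕ} {p : Fin (n + 1) → Icc t₀ T} (hp : StrictMono p)
    (c : Fin n → Fin (n + 1)) :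
    IsRandomClosedSet mΩ fun ω =>
      closedMinkowskiSum (B ω (p 0)) (growth G (p 0) t ω) ∪
        ⋃ i : Fin n, closedMinkowskiSum (increment B p i ω) (growth G (p (c i)) t ω) where
  nonempty ω := by
    obtain ⟨x, hx⟩ := (hB (p 0)).nonempty ω
    exact ⟨x + 0, Or.inl (subset_closure (Set.add_mem_add hx (zero_mem_growth hG_zero _ _ _)))⟩
  isClosed ω := isClosed_closure.union (isClosed_iUnion_of_finite fun _ => isClosed_closure)
  measurable := by
    have hB0 : IsMeasurableSetValued mΩ fun ω => B ω (p 0) := fun O hO =>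
      ℱ.le _ _ ((hB (p 0)).measurable O hO)
    exact (hB0.closedMinkowskiSum (isMeasurableSetValued_growth hG _ _)).union
      (.iUnion fun i => (isMeasurableSetValued_increment hB hB_mono hp i).closedMinkowskiSum
        (isMeasurableSetValued_growth hG _ _))

end Sums

end BirthGrowth

theorem mainTheorem8
    {E : Type*} [NormedAddCommGroup E] [NormedSpace ℝ E] [CompleteSpace E]
    (hrefl : BirthGrowth.IsReflexiveSpace E)
    (hsep : TopologicalSpace.SeparableSpace (StrongDual ℝ E))
    {t₀ T : ℝ}
    {Ω : Type*} {mΩ : MeasurableSpace Ω} (ℙ : Measure Ω) [IsProbabilityMeasure ℙ]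
    [ℙ.IsComplete]
    (ℱ : Filtration (Icc t₀ T) mΩ) (hℱ : BirthGrowth.UsualConditions ℙ ℱ)
    (B G : Ω → Icc t₀ T → Set E)
    (hB_adapted : BirthGrowth.IsAdaptedClosed ℱ B)
    (hB_mono : ∀ ω, ∀ s t : Icc t₀ T, s < t → B ω s ⊆ B ω t)
    (hG_closed : ∀ ω t, IsClosed (G ω t))
    (hG_zero : ∀ ω t, (0 : E) ∈ G ω t)
    (hG_convex : ∀ ω t, Convex ℝ (G ω t))
    (hG_bounded : ∃ K : Set E, IsClosed K ∧ Bornology.IsBounded K ∧ ∀ ω t, G ω t ⊆ K)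
    (hG_previsible : BirthGrowth.IsMeasurableSetValued (BirthGrowth.previsible E ℙ ℱ)
      (fun p : Ω × Icc t₀ T => G p.1 p.2))
    (t : Icc t₀ T) (n : ℕ) (p : Fin (n + 1) → Icc t₀ T) (hp : BirthGrowth.IsPartition t p) :
    BirthGrowth.IsRandomClosedSet mΩ (BirthGrowth.lowerSum B G t p) ∧
      BirthGrowth.IsRandomClosedSet mΩ (BirthGrowth.upperSum B G t p) := by
  have := BirthGrowth.separableSpace_of_separableSpace_dual E
  have := UniformSpace.secondCountable_of_separable E
  have hG : BirthGrowth.IsRandomClosedSet (BirthGrowth.previsible E ℙ ℱ)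
      fun q : Ω × Icc t₀ T => G q.1 q.2 :=
    ⟨fun q => ⟨0, hG_zero _ _⟩, fun q => hG_closed _ _, hG_previsible⟩
  exact ⟨BirthGrowth.isRandomClosedSet_union_iUnion hB_adapted hB_mono hG_zero hG t
      hp.strictMono Fin.succ,
    BirthGrowth.isRandomClosedSet_union_iUnion hB_adapted hB_mono hG_zero hG t
      hp.strictMono Fin.castSucc⟩
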